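/- Let $\alpha=(\alpha_n)_{n\in\mathbb N}$, $\mathbb N=\{1,2,\dots\}$, be a strictly increasing sequence of positive real numbers with $\alpha_n\to\infty$, and let $(s_k)_{k\in\mathbb N}\subset(1,\infty)$ be strictly increasing with $s_k\to\infty$. Put $v_k(n)=s_k^{-\alpha_n}$, let $c_0(v_k)$ be the Banach space of all $x\in\mathbb C^{\mathbb N}$ with $\lim_n v_k(n)x_n=0$, with norm $\sup_n v_k(n)|x_n|$, and let $E_\alpha=\operatorname{ind}_k c_0(v_k)=\bigcup_k c_0(v_k)$, endowed with the finest locally convex Hausdorff topology for which all inclusions $c_0(v_k)\hookrightarrow E_\alpha$ are continuous. Let $\mathsf C\colon E_\alpha\to E_\alpha$, $\mathsf Cx=\bigl(\frac{x_1+\dots+x_n}{n}\bigr)_{n\in\mathbb N}$, be the Cesàro operator, which is a continuous linear operator on $E_\alpha$. Let $\sigma(\mathsf C;E_\alpha)$ be the set of all $\lambda\in\mathbb C$ for which $\lambda I-\mathsf C$ has no inverse in the algebra $\mathcal L(E_\alpha)$ of continuous linear operators on $E_\alpha$, and let $\sigma_{pt}(\mathsf C;E_\alpha)$ be the set of all $\lambda\in\mathbb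 C$ for which $\lambda I-\mathsf C$ is not injective on $E_\alpha$. Then the following assertions are equivalent: 1. $E_\alpha$ is nuclear; 2. $\sigma(\mathsf C;E_\alpha)=\sigma_{pt}(\mathsf C;E_\alpha)$; 3. $\sigma(\mathsf C;E_\alpha)=\{\frac1n : n\in\mathbb N\}$. -/

import Mathlib

open Filter Topology

/-! Sequences are indexed by `ℕ = {0, 1, 2, …}`: the term with index `n` here is the term with
index `n + 1` of a sequence that is indexed from `1`. -/

/-! ### Locally convex inductive limits -/

/-- The inductive limit topology on `E`: the finest vector space topology on `E` that is locally
convex and makes all the linear maps `ι k : F k → E` continuous. (In Mathlib's order on topologies,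
finer means smaller; the infimum of locally convex vector topologies is again one.) -/
@[reducible]
def inductiveTopology {κ : Type*} {F : κ → Type*} {E : Type*}
    [∀ k, AddCommGroup (F k)] [∀ k, Module ℂ (F k)] [∀ k, TopologicalSpace (F k)]
    [AddCommGroup E] [Module ℂ E] (ι : ∀ k, F k →ₗ[ℂ] E) : TopologicalSpace E :=
  sInf {t : TopologicalSpace E |
    @IsTopologicalAddGroup E t _ ∧ @ContinuousSMul ℂ E _ _ t ∧
    @LocallyConvexSpace ℝ E _ _ _ _ t ∧
    ∀ k, @Continuous (F k) E _ t (ι k)}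

section InductiveTopology

variable {κ : Type*} {F : κ → Type*} {E : Type*}
  [∀ k, AddCommGroup (F k)] [∀ k, Module ℂ (F k)] [∀ k, TopologicalSpace (F k)]
  [AddCommGroup E] [Module ℂ E]

theorem inductiveTopology_isTopologicalAddGroup (ι : ∀ k, F k →ₗ[ℂ] E) :
    @IsTopologicalAddGroup E (inductiveTopology ι) _ :=
  topologicalAddGroup_sInf fun _ ht => ht.1

theorem inductiveTopology_continuousSMul (ι : ∀ k, F k →ₗ[ℂ] E) :
    @ContinuousSMul ℂ E _ _ (inductiveTopology ι) :=
  continuousSMul_sInf fun _ ht => ht.2.1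

theorem inductiveTopology_locallyConvexSpace (ι : ∀ k, F k →ₗ[ℂ] E) :
    @LocallyConvexSpace ℝ E _ _ _ _ (inductiveTopology ι) :=
  LocallyConvexSpace.sInf fun _ ht => ht.2.2.1

theorem inductiveTopology_continuous_incl (ι : ∀ k, F k →ₗ[ℂ] E) (k : κ) :
    @Continuous (F k) E _ (inductiveTopology ι) (ι k) :=
  continuous_sInf_rng.2 fun _ ht => ht.2.2.2 k

/-- The universal property: a linear map from an inductive limit to a locally convex space is
continuous if its restriction to every step is continuous. -/
theorem inductiveTopology_continuous_of_steps (ι : ∀ k, F k →ₗ[ℂ] E)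
    {G : Type*} [AddCommGroup G] [Module ℂ G] [tG : TopologicalSpace G]
    [IsTopologicalAddGroup G] [ContinuousSMul ℂ G] [LocallyConvexSpace ℝ G]
    (f : E →ₗ[ℂ] G) (hf : ∀ k, Continuous fun x => f (ι k x)) :
    @Continuous E G (inductiveTopology ι) _ f := by
  refine continuous_iff_le_induced.2 (sInf_le ⟨?_, ?_, ?_, ?_⟩)
  · exact topologicalAddGroup_induced f
  · exact continuousSMul_induced f
  · exact LocallyConvexSpace.induced (f.restrictScalars ℝ)
  · intro k
    exact continuous_induced_rng.2 (hf k)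

end InductiveTopology

/-! ### Weighted `c₀` spaces -/

/-- The vector space of all complex sequences `x` such that `v n * x n → 0`. -/
def weightedC0Submodule (v : ℕ → ℝ) : Submodule ℂ (ℕ → ℂ) where
  carrier := {x | Tendsto (fun n => v n • x n) atTop (𝓝 0)}
  zero_mem' := by simp
  add_mem' := by
    intro x y hx hy
    have h := Tendsto.add hx hy
    simp only [add_zero] at h
    exact h.congr fun n => (smul_add (v n) (x n) (y n)).symm
  smul_mem' := by
    intro c x hx
    have h := Tendsto.const_smul hx c
    simp only [smul_zero] at h
    refine h.congr fun n => ?_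
    rw [Pi.smul_apply, smul_comm]

/-- The weighted space `c₀(v)`. It is a type of its own because its topology is given by the
weighted supremum norm below and not by coordinatewise convergence. -/
def WeightedC0 (v : ℕ → ℝ) : Type := weightedC0Submodule v

namespace WeightedC0

variable (v : ℕ → ℝ)

noncomputable instance : AddCommGroup (WeightedC0 v) :=
  inferInstanceAs (AddCommGroup (weightedC0Submodule v))

noncomputable instance : Module ℂ (WeightedC0 v) :=
  inferInstanceAs (Module ℂ (weightedC0Submodule v))

/-- The underlying sequence. -/
def toSeq : WeightedC0 v →ₗ[ℂ] (ℕ → ℂ) := (weightedC0Submodule v).subtype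

/-- The norm `sup_n v n * |x n|` of `c₀(v)`. It is a norm if all `v n` are nonzero. -/
noncomputable instance : Norm (WeightedC0 v) where
  norm x := ⨆ n, ‖v n • toSeq v x n‖

theorem bddAbove (x : WeightedC0 v) :
    BddAbove (Set.range fun n => ‖v n • toSeq v x n‖) :=
  (Tendsto.norm (show Tendsto (fun n => v n • toSeq v x n) atTop (𝓝 0) from x.2)).bddAbove_range

theorem le_norm (x : WeightedC0 v) (n : ℕ) : ‖v n • toSeq v x n‖ ≤ ‖x‖ :=
  le_ciSup (bddAbove v x) n

theorem seminormedSpaceCore : SeminormedSpace.Core ℂ (WeightedC0 v) where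
  norm_nonneg x := Real.iSup_nonneg fun _ => norm_nonneg _
  norm_smul c x := by
    change (⨆ n, ‖v n • toSeq v (c • x) n‖) = ‖c‖ * ⨆ n, ‖v n • toSeq v x n‖
    rw [Real.mul_iSup_of_nonneg (norm_nonneg c)]
    congr 1
    ext n
    rw [map_smul, Pi.smul_apply, smul_comm, norm_smul]
  norm_triangle x y := by
    refine ciSup_le fun n => ?_
    rw [map_add, Pi.add_apply, smul_add]
    exact (norm_add_le _ _).trans (add_le_add (le_norm v x n) (le_norm v y n))

noncomputable instance : SeminormedAddCommGroup (WeightedC0 v) :=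
  SeminormedAddCommGroup.ofCore (seminormedSpaceCore v)

noncomputable instance : NormedSpace ℂ (WeightedC0 v) where
  norm_smul_le c x := ((seminormedSpaceCore v).norm_smul c x).le

end WeightedC0

/-! ### The space `E_α`, the strong dual of a power series space of infinite type -/

/-- The weights `v_k(n) = s_k ^ (-α_n)`. -/
noncomputable def coechelonWeight (α s : ℕ → ℝ) (k n : ℕ) : ℝ := s k ^ (-α n)

/-- The vector space of sequences `⋃ k, c₀(v_k)`. The steps increase with `k` when `s` increases
(and `1 < s k`, `0 < α n`), and then their sum is their union. -/
noncomputable def coechelonSubmodule (α s : ℕ → ℝ) : Submodule ℂ (ℕ → ℂ) :=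
  ⨆ k, weightedC0Submodule (coechelonWeight α s k)

/-- The co-echelon space `E_α = ind_k c₀(v_k)`. It is a type of its own because its topology is the
inductive limit topology below and not that of coordinatewise convergence. -/
def CoechelonSpace (α s : ℕ → ℝ) : Type := coechelonSubmodule α s

namespace CoechelonSpace

variable (α s : ℕ → ℝ)

noncomputable instance : AddCommGroup (CoechelonSpace α s) :=
  inferInstanceAs (AddCommGroup (coechelonSubmodule α s))

noncomputable instance : Module ℂ (CoechelonSpace α s) :=
  inferInstanceAs (Module ℂ (coechelonSubmodule α s))

/-- The underlying sequence. -/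
noncomputable def toSeq : CoechelonSpace α s →ₗ[ℂ] (ℕ → ℂ) := (coechelonSubmodule α s).subtype

/-- The inclusion of the step `c₀(v_k)`. -/
noncomputable def incl (k : ℕ) :
    WeightedC0 (coechelonWeight α s k) →ₗ[ℂ] CoechelonSpace α s :=
  Submodule.inclusion (le_iSup (fun k => weightedC0Submodule (coechelonWeight α s k)) k)

noncomputable instance : TopologicalSpace (CoechelonSpace α s) := inductiveTopology (incl α s)

instance : IsTopologicalAddGroup (CoechelonSpace α s) :=
  inductiveTopology_isTopologicalAddGroup (incl α s)

instance : ContinuousSMul ℂ (CoechelonSpace α s) :=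
  inductiveTopology_continuousSMul (incl α s)

instance : LocallyConvexSpace ℝ (CoechelonSpace α s) :=
  inductiveTopology_locallyConvexSpace (incl α s)

variable {α s}

/-- `E_α` is the union of its steps. -/
theorem mem_coechelonSubmodule_iff (hα : ∀ n, 0 < α n) (hs : StrictMono s) (hs1 : ∀ k, 1 < s k)
    (x : ℕ → ℂ) :
    x ∈ coechelonSubmodule α s ↔
      ∃ k, Tendsto (fun n => coechelonWeight α s k n • x n) atTop (𝓝 0) := by
  refine Submodule.mem_iSup_of_directed _ (Monotone.directed_le fun k l hkl x hx => ?_)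
  have hx' : Tendsto (fun n => coechelonWeight α s k n • x n) atTop (𝓝 0) := hx
  refine squeeze_zero_norm (fun n => ?_) (tendsto_zero_iff_norm_tendsto_zero.1 hx')
  have h0 : 0 < s k := one_pos.trans (hs1 k)
  have h1 : 0 < s l := one_pos.trans (hs1 l)
  rw [norm_smul, norm_smul]
  refine mul_le_mul_of_nonneg_right ?_ (norm_nonneg _)
  rw [coechelonWeight, coechelonWeight, Real.norm_of_nonneg (Real.rpow_nonneg h1.le _),
    Real.norm_of_nonneg (Real.rpow_nonneg h0.le _)]
  exact Real.rpow_le_rpow_of_nonpos h0 (hs.monotone hkl) (neg_nonpos.2 (hα n).le)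

/-- The topology of `E_α` is Hausdorff. -/
theorem t2Space (hs1 : ∀ k, 1 < s k) : T2Space (CoechelonSpace α s) := by
  have hc : Continuous (toSeq α s) := by
    refine inductiveTopology_continuous_of_steps (incl α s) (toSeq α s) fun k => ?_
    refine continuous_pi fun n => ?_
    have hw : 0 < coechelonWeight α s k n := Real.rpow_pos_of_pos (one_pos.trans (hs1 k)) _
    refine AddMonoidHomClass.continuous_of_bound
      ((LinearMap.proj n).comp (WeightedC0.toSeq (coechelonWeight α s k)) :
        WeightedC0 (coechelonWeight α s k) →ₗ[ℂ] ℂ) (coechelonWeight α s k n)⁻¹ fun x => ?_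
    have h := WeightedC0.le_norm (coechelonWeight α s k) x n
    rw [norm_smul, Real.norm_of_nonneg hw.le] at h
    exact (le_inv_mul_iff₀ hw).2 h
  exact T2Space.of_injective_continuous Subtype.val_injective hc

end CoechelonSpace

/-! ### The Cesàro operator -/

/-- The Cesàro operator on the space of all complex sequences,
`(C x) n = (x 0 + ⋯ + x n) / (n + 1)`. -/
noncomputable def cesaroSeq : (ℕ → ℂ) →ₗ[ℂ] (ℕ → ℂ) where
  toFun x n := (∑ i ∈ Finset.range (n + 1), x i) / ((n : ℂ) + 1)
  map_add' x y := by
    ext n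
    simp [Finset.sum_add_distrib, add_div]
  map_smul' c x := by
    ext n
    simp [← Finset.mul_sum, mul_div_assoc]

/-- For a decreasing nonnegative weight the Cesàro means of `x` are dominated by those of the
weighted sequence. -/
theorem norm_smul_cesaroSeq_le {v : ℕ → ℝ} (hv : Antitone v) (hv0 : ∀ n, 0 ≤ v n)
    (x : ℕ → ℂ) (n : ℕ) :
    ‖v n • cesaroSeq x n‖ ≤
      ((n + 1 : ℕ) : ℝ)⁻¹ * ∑ i ∈ Finset.range (n + 1), ‖v i • x i‖ := by
  have h1 : v n • cesaroSeq x n =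
      (((n + 1 : ℕ) : ℝ)⁻¹) • ∑ i ∈ Finset.range (n + 1), v n • x i := by
    rw [← Finset.smul_sum, smul_comm]
    congr 1
    simp [cesaroSeq, div_eq_inv_mul]
  rw [h1, norm_smul, Real.norm_of_nonneg (by positivity)]
  refine mul_le_mul_of_nonneg_left ((norm_sum_le _ _).trans ?_) (by positivity)
  refine Finset.sum_le_sum fun i hi => ?_
  rw [norm_smul, norm_smul, Real.norm_of_nonneg (hv0 n), Real.norm_of_nonneg (hv0 i)]
  exact mul_le_mul_of_nonneg_right (hv (Nat.lt_succ_iff.1 (Finset.mem_range.1 hi)))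
    (norm_nonneg _)

theorem cesaroSeq_mem_weightedC0 {v : ℕ → ℝ} (hv : Antitone v) (hv0 : ∀ n, 0 ≤ v n)
    {x : ℕ → ℂ} (hx : x ∈ weightedC0Submodule v) : cesaroSeq x ∈ weightedC0Submodule v := by
  have hx' : Tendsto (fun n => ‖v n • x n‖) atTop (𝓝 0) := by
    simpa using Tendsto.norm (show Tendsto (fun n => v n • x n) atTop (𝓝 0) from hx)
  exact squeeze_zero_norm (norm_smul_cesaroSeq_le hv hv0 x)
    (hx'.cesaro.comp (tendsto_add_atTop_nat 1))

theorem coechelonWeight_antitone {α s : ℕ → ℝ} (hα : StrictMono α) (hs : ∀ k, 1 < s k) (k : ℕ) :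
    Antitone (coechelonWeight α s k) := fun _ _ hmn =>
  Real.rpow_le_rpow_of_exponent_le (hs k).le (neg_le_neg (hα.monotone hmn))

theorem coechelonWeight_nonneg {α s : ℕ → ℝ} (hs : ∀ k, 1 < s k) (k n : ℕ) :
    0 ≤ coechelonWeight α s k n :=
  Real.rpow_nonneg (one_pos.trans (hs k)).le _

namespace CoechelonSpace

variable {α s : ℕ → ℝ}

theorem cesaroSeq_mem (hα : StrictMono α) (hs : ∀ k, 1 < s k) :
    ∀ x ∈ coechelonSubmodule α s, cesaroSeq x ∈ coechelonSubmodule α s := by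
  change coechelonSubmodule α s ≤ (coechelonSubmodule α s).comap cesaroSeq
  refine iSup_le fun k x hx => ?_
  exact Submodule.mem_iSup_of_mem k (cesaroSeq_mem_weightedC0
    (coechelonWeight_antitone hα hs k) (coechelonWeight_nonneg hs k) hx)

/-- The Cesàro operator acting on the vector space `E_α`. -/
noncomputable def cesaroLin (hα : StrictMono α) (hs : ∀ k, 1 < s k) :
    CoechelonSpace α s →ₗ[ℂ] CoechelonSpace α s :=
  cesaroSeq.restrict (cesaroSeq_mem hα hs)

theorem continuous_cesaroLin (hα : StrictMono α) (hs : ∀ k, 1 < s k) :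
    Continuous (cesaroLin hα hs) := by
  refine inductiveTopology_continuous_of_steps (incl α s) (cesaroLin hα hs) fun k => ?_
  have hv := coechelonWeight_antitone hα hs k
  have hv0 := coechelonWeight_nonneg (α := α) hs k
  let T : WeightedC0 (coechelonWeight α s k) →ₗ[ℂ] WeightedC0 (coechelonWeight α s k) :=
    cesaroSeq.restrict (p := weightedC0Submodule (coechelonWeight α s k))
      (q := weightedC0Submodule (coechelonWeight α s k))
      fun _ hx => cesaroSeq_mem_weightedC0 hv hv0 hx
  have hT : Continuous T := by
    refine AddMonoidHomClass.continuous_of_bound T 1 fun x => ?_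
    refine ciSup_le fun n => (norm_smul_cesaroSeq_le hv hv0 _ n).trans ?_
    rw [one_mul, inv_mul_le_iff₀ (by positivity)]
    refine (Finset.sum_le_card_nsmul _ _ ‖x‖ fun i _ => WeightedC0.le_norm _ x i).trans ?_
    simp
  exact (inductiveTopology_continuous_incl (incl α s) k).comp hT

/-- The Cesàro operator `C ∈ L(E_α)`. -/
noncomputable def cesaro (hα : StrictMono α) (hs : ∀ k, 1 < s k) :
    CoechelonSpace α s →L[ℂ] CoechelonSpace α s :=
  ⟨cesaroLin hα hs, continuous_cesaroLin hα hs⟩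

end CoechelonSpace

/-! ### Point spectrum

The spectrum of `T ∈ L(X)` is Mathlib's `spectrum ℂ T` in the algebra `X →L[ℂ] X`: the set of all
`z` such that `z • 1 - T` has no inverse in `X →L[ℂ] X`. -/

/-- The point spectrum: all `z` such that `z • 1 - T` is not injective. -/
def pointSpectrum {X : Type*} [AddCommGroup X] [Module ℂ X] [TopologicalSpace X]
    [IsTopologicalAddGroup X] [ContinuousConstSMul ℂ X] (T : X →L[ℂ] X) : Set ℂ :=
  {z | ¬ Function.Injective (z • (1 : X →L[ℂ] X) - T)}

/-! ### Nuclear spaces -/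

/-- A continuous linear map `T` between normed spaces is nuclear if `T x = ∑ j, a_j(x) y_j` for
continuous linear functionals `a_j` and vectors `y_j` with `∑ j, ‖a_j‖ ‖y_j‖ < ∞`. -/
def IsNuclearMap {X Y : Type*} [NormedAddCommGroup X] [NormedSpace ℂ X]
    [NormedAddCommGroup Y] [NormedSpace ℂ Y] (T : X →L[ℂ] Y) : Prop :=
  ∃ (a : ℕ → X →L[ℂ] ℂ) (y : ℕ → Y), Summable (fun j => ‖a j‖ * ‖y j‖) ∧
    ∀ x, HasSum (fun j => a j x • y j) (T x)

/-- The vector space `E` with the topology of the single seminorm `p`. -/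
def SeminormSpace {E : Type*} [AddCommGroup E] [Module ℂ E] (_p : Seminorm ℂ E) : Type _ := E

namespace SeminormSpace

variable {E : Type*} [AddCommGroup E] [Module ℂ E]

noncomputable instance (p : Seminorm ℂ E) : SeminormedAddCommGroup (SeminormSpace p) :=
  AddGroupSeminorm.toSeminormedAddCommGroup (E := E) p.toAddGroupSeminorm

instance (p : Seminorm ℂ E) : Module ℂ (SeminormSpace p) := inferInstanceAs (Module ℂ E)

noncomputable instance (p : Seminorm ℂ E) : NormedSpace ℂ (SeminormSpace p) where
  norm_smul_le c x := (map_smul_eq_mul p c x).le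

/-- The identity of `E` as a continuous linear map from `(E, q)` to `(E, p)` for `p ≤ q`. -/
def idMap {p q : Seminorm ℂ E} (h : p ≤ q) : SeminormSpace q →L[ℂ] SeminormSpace p where
  toFun x := x
  map_add' _ _ := rfl
  map_smul' _ _ := rfl
  cont := AddMonoidHomClass.continuous_of_bound
    (⟨⟨id, fun _ _ => rfl⟩, fun _ _ => rfl⟩ : SeminormSpace q →ₗ[ℂ] SeminormSpace p) 1
    fun x => (h x).trans (one_mul (q x)).ge

end SeminormSpace

/-- The local Banach space `E_p` of a seminorm `p`: the completion of `E / ker p` with the norm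
induced by `p`, that is, the Hausdorff completion of `(E, p)`. -/
abbrev LocalBanachSpace {E : Type*} [AddCommGroup E] [Module ℂ E] (p : Seminorm ℂ E) : Type _ :=
  UniformSpace.Completion (SeminormSpace p)

/-- The canonical (linking) map `E_q → E_p` for seminorms `p ≤ q`. -/
noncomputable def linkingMap {E : Type*} [AddCommGroup E] [Module ℂ E] {p q : Seminorm ℂ E}
    (h : p ≤ q) : LocalBanachSpace q →L[ℂ] LocalBanachSpace p :=
  (SeminormSpace.idMap h).completion

/-- A locally convex space is nuclear if for every continuous seminorm `p` there is a continuous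
seminorm `q ≥ p` such that the canonical map `E_q → E_p` of local Banach spaces is nuclear. -/
def IsNuclearSpace (E : Type*) [AddCommGroup E] [Module ℂ E] [TopologicalSpace E] : Prop :=
  ∀ p : Seminorm ℂ E, Continuous p →
    ∃ q : Seminorm ℂ E, Continuous q ∧ ∃ h : p ≤ q, IsNuclearMap (linkingMap h)

/-! All three assertions are equivalent to `log n = O(α n)`, encoded as `HasLogGrowth`. Because
products of weights are again weights of the same kind, this condition says that every polynomial
factor can be absorbed by passing to a later step (`HasLogGrowth.exists_pow_mul_le`).

Spectrum. For the partial sums `S n` of the first `n` terms of `x`, the equation `z x - C x = y` is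
the recurrence `(z - 1/(n+1)) S (n+1) = z S n + y n`. If `z` is none of the points `1/(n+1)`, it is
uniquely solvable with polynomially bounded entries (`exists_norm_le_of_resolvent`), so log growth
makes the resolvent continuous on `E_α`. The points `1/(N+1)` are always in the spectrum; their
eigensequence `n.choose N` is polynomial and belongs to `E_α` under log growth. Conversely, an
eigenvector for `1/2`, or a preimage of `(-1)^n` under `-C`, grows linearly, and a sequence of
linear growth in `E_α` forces log growth.

Nuclearity. Under log growth a continuous seminorm is dominated by a weighted `ℓ¹` seminorm with
room for a factor `(n+1)^2`, and the expansion in unit vectors is a nuclear representation of the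
linking map. Without log growth some non-summable weight `w` is dominated by every `v_k`; nuclearity
at the `w`-weighted sup seminorm would bound the trace `∑ w n`. -/

/-! ### The growth condition `log n = O(α n)` -/

theorem coechelonWeight_pos {α s : ℕ → ℝ} (hs : ∀ k, 1 < s k) (k n : ℕ) :
    0 < coechelonWeight α s k n :=
  Real.rpow_pos_of_pos (one_pos.trans (hs k)) _

theorem coechelonWeight_anti_left {α s : ℕ → ℝ} (hα : ∀ n, 0 < α n) (hs : ∀ k, 1 < s k)
    (hs_mono : StrictMono s) (n : ℕ) : Antitone fun k => coechelonWeight α s k n := fun k _ hkl =>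
  Real.rpow_le_rpow_of_nonpos (one_pos.trans (hs k)) (hs_mono.monotone hkl)
    (neg_nonpos.2 (hα n).le)

/-- The condition `log n = O(α n)`: some weight decays at least like `1 / n`. -/
def HasLogGrowth (α s : ℕ → ℝ) : Prop :=
  ∃ (k : ℕ) (C : ℝ), ∀ n : ℕ, ((n : ℝ) + 1) * coechelonWeight α s k n ≤ C

/-- Weights multiply through their bases: `(s m ^ d * s k) ^ (-α n) = v_m(n)^d v_k(n)`. Any `l` with
`s l ≥ s m ^ d * s k` therefore works, the factor `v_m(n)^d` cancelling the power of `n + 1`. -/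
theorem HasLogGrowth.exists_pow_mul_le {α s : ℕ → ℝ} (h : HasLogGrowth α s)
    (hα : ∀ n, 0 < α n) (hs : ∀ k, 1 < s k) (hs_top : Tendsto s atTop atTop) (d k : ℕ) :
    ∃ (l : ℕ) (C : ℝ), 0 ≤ C ∧
      ∀ n : ℕ, ((n : ℝ) + 1) ^ d * coechelonWeight α s l n ≤ C * coechelonWeight α s k n := by
  obtain ⟨m, C, hC⟩ := h
  obtain ⟨l, hl⟩ := (hs_top.eventually_ge_atTop (s m ^ d * s k)).exists
  have hC0 : 0 ≤ C := le_trans (by have := coechelonWeight_nonneg (α := α) hs m 0; positivity) (hC 0)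
  refine ⟨l, C ^ d, by positivity, fun n => ?_⟩
  have hm : 0 < s m := one_pos.trans (hs m)
  have hk : 0 < s k := one_pos.trans (hs k)
  have h1 : coechelonWeight α s l n ≤ coechelonWeight α s m n ^ d * coechelonWeight α s k n := by
    have := Real.rpow_le_rpow_of_nonpos (z := -α n) (by positivity) hl (neg_nonpos.2 (hα n).le)
    rwa [Real.mul_rpow (by positivity) hk.le, ← Real.rpow_pow_comm hm.le] at this
  calc ((n : ℝ) + 1) ^ d * coechelonWeight α s l n
      ≤ ((n : ℝ) + 1) ^ d * (coechelonWeight α s m n ^ d * coechelonWeight α s k n) := by gcongr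
    _ = (((n : ℝ) + 1) * coechelonWeight α s m n) ^ d * coechelonWeight α s k n := by
        rw [mul_pow]; ring
    _ ≤ C ^ d * coechelonWeight α s k n := by
        have := coechelonWeight_nonneg (α := α) hs m n
        have := coechelonWeight_nonneg (α := α) hs k n
        have := hC n
        gcongr

namespace CoechelonSpace

variable {α s : ℕ → ℝ}

@[ext]
theorem ext {x y : CoechelonSpace α s} (h : ∀ n, toSeq α s x n = toSeq α s y n) : x = y :=
  Subtype.ext (funext h)

theorem exists_toSeq_eq {x : ℕ → ℂ} {k : ℕ}
    (h : Tendsto (fun n => coechelonWeight α s k n • x n) atTop (𝓝 0)) :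
    ∃ y : CoechelonSpace α s, toSeq α s y = x :=
  ⟨⟨x, Submodule.mem_iSup_of_mem k h⟩, rfl⟩

theorem exists_incl_eq (hα : ∀ n, 0 < α n) (hs : StrictMono s) (hs1 : ∀ k, 1 < s k)
    (x : CoechelonSpace α s) : ∃ k y, incl α s k y = x := by
  obtain ⟨k, hk⟩ := (mem_coechelonSubmodule_iff hα hs hs1 _).1 x.2
  exact ⟨k, ⟨_, hk⟩, rfl⟩

/-- Membership in some step bounds `v_k(n) |x_n|`, and the linear lower bound turns this into a
bound for `n v_k(n)`. -/
theorem hasLogGrowth_of_linear_le (hα : ∀ n, 0 < α n) (hs : StrictMono s) (hs1 : ∀ k, 1 < s k)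
    (x : CoechelonSpace α s) {c : ℝ} (hc : 0 < c)
    (hx : ∀ n : ℕ, c * (n + 1) ≤ ‖toSeq α s x (n + 1)‖) : HasLogGrowth α s := by
  obtain ⟨k, y, rfl⟩ := exists_incl_eq hα hs hs1 x
  -- The first summand covers index `0`; the factor `2` comes from `n + 2 ≤ 2 (n + 1)` at index `n +
  -- 1`.
  refine ⟨k, coechelonWeight α s k 0 + 2 * (‖y‖ / c), fun n => ?_⟩
  have h0 : 0 ≤ ‖y‖ := norm_nonneg y
  cases n with
  | zero => simp; positivity
  | succ n =>
    have h := WeightedC0.le_norm _ y (n + 1)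
    have hw := coechelonWeight_nonneg (α := α) hs1 k (n + 1)
    have hw0 := coechelonWeight_nonneg (α := α) hs1 k 0
    rw [norm_smul, Real.norm_of_nonneg hw] at h
    have h2 := (mul_le_mul_of_nonneg_left (hx n) hw).trans h
    have h3 : coechelonWeight α s k (n + 1) * (n + 1) ≤ ‖y‖ / c := by
      rw [le_div_iff₀ hc]; linarith
    push_cast
    nlinarith [mul_nonneg hw (Nat.cast_nonneg (α := ℝ) n)]

/-! ### Operators dominated by polynomial multiples of partial sums -/

/-- As `v_k` decreases, `v_k(n) ∑_{i ≤ n} |x_i| ≤ (n+1) ‖x‖`. Of the `D + 2` powers, `D + 1` absorb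
the polynomial and this factor; the last one gives decay, so that `z` lies in `c₀(v_l)` and is not
merely bounded there. -/
theorem weighted_le_of_partialSum_le (hα : StrictMono α) (hs1 : ∀ k, 1 < s k) {k l D : ℕ} {B C : ℝ}
    (hB : 0 ≤ B) (hC : 0 ≤ C)
    (hl : ∀ n : ℕ, ((n : ℝ) + 1) ^ (D + 2) * coechelonWeight α s l n ≤ C * coechelonWeight α s k n)
    {x : WeightedC0 (coechelonWeight α s k)} {z : ℕ → ℂ}
    (hz : ∀ n : ℕ, ‖z n‖ ≤ B * (n + 1) ^ D *
      ∑ i ∈ Finset.range (n + 1), ‖WeightedC0.toSeq _ x i‖) (n : ℕ) :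
    ‖coechelonWeight α s l n • z n‖ ≤ B * C * ‖x‖ * (1 / ((n : ℝ) + 1)) := by
  have hwl := coechelonWeight_nonneg (α := α) hs1 l n
  have hwk := coechelonWeight_nonneg (α := α) hs1 k
  have hsum : coechelonWeight α s k n * ∑ i ∈ Finset.range (n + 1), ‖WeightedC0.toSeq _ x i‖
      ≤ (n + 1) * ‖x‖ := by
    rw [Finset.mul_sum]
    refine (Finset.sum_le_card_nsmul _ _ ‖x‖ fun i hi => ?_).trans (by simp)
    refine le_trans ?_ (WeightedC0.le_norm _ x i)
    rw [norm_smul, Real.norm_of_nonneg (hwk i)]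
    exact mul_le_mul_of_nonneg_right (coechelonWeight_antitone hα hs1 k
      (Nat.lt_succ_iff.1 (Finset.mem_range.1 hi))) (norm_nonneg _)
  set S := ∑ i ∈ Finset.range (n + 1), ‖WeightedC0.toSeq _ x i‖
  have hS : 0 ≤ S := Finset.sum_nonneg fun _ _ => norm_nonneg _
  rw [norm_smul, Real.norm_of_nonneg hwl, mul_one_div, le_div_iff₀ (by positivity)]
  have hn : (0 : ℝ) < n + 1 := by positivity
  refine le_of_mul_le_mul_right ?_ hn
  calc coechelonWeight α s l n * ‖z n‖ * (n + 1) * (n + 1)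
      ≤ coechelonWeight α s l n * (B * (n + 1) ^ D * S) * (n + 1) * (n + 1) := by
        gcongr; exact hz n
    _ = B * S * (((n : ℝ) + 1) ^ (D + 2) * coechelonWeight α s l n) := by ring
    _ ≤ B * S * (C * coechelonWeight α s k n) :=
        mul_le_mul_of_nonneg_left (hl n) (by positivity)
    _ = B * C * (coechelonWeight α s k n * S) := by ring
    _ ≤ B * C * ((n + 1) * ‖x‖) := by gcongr
    _ = B * C * ‖x‖ * (n + 1) := by ring

theorem tendsto_of_norm_le_div {z : ℕ → ℂ} {c : ℝ} (h : ∀ n : ℕ, ‖z n‖ ≤ c * (1 / ((n : ℝ) + 1))) :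
    Tendsto z atTop (𝓝 0) :=
  squeeze_zero_norm h (by simpa using tendsto_one_div_add_atTop_nhds_zero_nat.const_mul c)

theorem exists_toSeq_eq_of_partialSum_le (h : HasLogGrowth α s) (hα_pos : ∀ n, 0 < α n)
    (hα : StrictMono α) (hs : ∀ k, 1 < s k) (hs_mono : StrictMono s)
    (hs_top : Tendsto s atTop atTop) (x : CoechelonSpace α s) {z : ℕ → ℂ} {B : ℝ} {D : ℕ}
    (hB : 0 ≤ B)
    (hz : ∀ n : ℕ, ‖z n‖ ≤ B * (n + 1) ^ D * ∑ i ∈ Finset.range (n + 1), ‖toSeq α s x i‖) :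
    ∃ y : CoechelonSpace α s, toSeq α s y = z := by
  obtain ⟨k, x, rfl⟩ := exists_incl_eq hα_pos hs_mono hs x
  obtain ⟨l, C, hC, hl⟩ := h.exists_pow_mul_le hα_pos hs hs_top (D + 2) k
  exact exists_toSeq_eq (k := l)
    (tendsto_of_norm_le_div (weighted_le_of_partialSum_le hα hs hB hC hl hz))

theorem continuous_of_partialSum_le (h : HasLogGrowth α s) (hα_pos : ∀ n, 0 < α n)
    (hα : StrictMono α) (hs : ∀ k, 1 < s k)
    (hs_top : Tendsto s atTop atTop) (f : CoechelonSpace α s →ₗ[ℂ] CoechelonSpace α s)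
    {B : ℝ} {D : ℕ} (hB : 0 ≤ B)
    (hf : ∀ x, ∀ n : ℕ, ‖toSeq α s (f x) n‖ ≤
      B * (n + 1) ^ D * ∑ i ∈ Finset.range (n + 1), ‖toSeq α s x i‖) :
    Continuous f := by
  refine inductiveTopology_continuous_of_steps (incl α s) f fun k => ?_
  obtain ⟨l, C, hC, hl⟩ := h.exists_pow_mul_le hα_pos hs hs_top (D + 2) k
  have hb (x : WeightedC0 (coechelonWeight α s k)) :=
    weighted_le_of_partialSum_le hα hs hB hC hl (hf (incl α s k x))
  let T : WeightedC0 (coechelonWeight α s k) →ₗ[ℂ] WeightedC0 (coechelonWeight α s l) :=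
    LinearMap.codRestrict (weightedC0Submodule (coechelonWeight α s l))
      (toSeq α s ∘ₗ f ∘ₗ incl α s k) fun x => tendsto_of_norm_le_div (hb x)
  have hT : Continuous T := by
    refine AddMonoidHomClass.continuous_of_bound T (B * C) fun x => ciSup_le fun n => ?_
    refine (hb x n).trans (mul_le_of_le_one_right (by positivity) ?_)
    rw [div_le_one (by positivity)]
    linarith [Nat.cast_nonneg (α := ℝ) n]
  exact (inductiveTopology_continuous_incl (incl α s) l).comp hT

end CoechelonSpace

/-! ### The resolvent of the Cesàro operator on the space of all sequences -/

theorem smul_sub_cesaroSeq_apply (z : ℂ) (x : ℕ → ℂ) (n : ℕ) :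
    z * x n - cesaroSeq x n =
      (z - 1 / ((n : ℂ) + 1)) * ∑ i ∈ Finset.range (n + 1), x i -
        z * ∑ i ∈ Finset.range n, x i := by
  have : cesaroSeq x n = (∑ i ∈ Finset.range (n + 1), x i) / ((n : ℂ) + 1) := rfl
  rw [this, Finset.sum_range_succ]
  ring

/-- The points `1/(n+1)` accumulate only at `0`, so for `z ≠ 0` their distance from `z` is bounded
below. For `z = 0` the distance is exactly `1/(n+1)`, whence the factor `n + 1` in the second bound.
`A` is a natural number because it becomes an exponent. -/
theorem exists_resolvent_bound {z : ℂ} (hz : ∀ n : ℕ, z ≠ 1 / ((n : ℂ) + 1)) :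
    ∃ A : ℕ, ∀ n : ℕ, ‖z‖ ≤ (1 + A / ((n : ℝ) + 1)) * ‖z - 1 / ((n : ℂ) + 1)‖ ∧
      1 ≤ A * ((n : ℝ) + 1) * ‖z - 1 / ((n : ℂ) + 1)‖ := by
  have hn (n : ℕ) : ‖(n : ℂ) + 1‖ = (n : ℝ) + 1 := by
    rw [← Nat.cast_add_one, Complex.norm_natCast, Nat.cast_add_one]
  obtain rfl | hz0 := eq_or_ne z 0
  · refine ⟨1, fun n => ⟨by simp; positivity, ?_⟩⟩
    rw [zero_sub, norm_neg, norm_div, hn, norm_one]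
    field_simp
    simp
  have hlim : Tendsto (fun n : ℕ => 1 / ‖z - 1 / ((n : ℂ) + 1)‖) atTop (𝓝 (1 / ‖z - 0‖)) := by
    refine tendsto_const_nhds.div ?_ (by simpa using hz0)
    exact (tendsto_const_nhds.sub tendsto_one_div_add_atTop_nhds_zero_nat).norm
  obtain ⟨M, hM⟩ := hlim.bddAbove_range
  obtain ⟨A, hA⟩ := exists_nat_ge M
  refine ⟨A, fun n => ?_⟩
  have hpos : 0 < ‖z - 1 / ((n : ℂ) + 1)‖ := norm_pos_iff.2 (sub_ne_zero.2 (hz n))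
  have h1 : 1 ≤ A * ‖z - 1 / ((n : ℂ) + 1)‖ :=
    (div_le_iff₀ hpos).1 ((hM ⟨n, rfl⟩).trans hA)
  have hn0 : (0 : ℝ) < n + 1 := by positivity
  constructor
  · have h2 : ‖z‖ ≤ ‖z - 1 / ((n : ℂ) + 1)‖ + 1 / ((n : ℝ) + 1) := by
      have := norm_add_le (z - 1 / ((n : ℂ) + 1)) (1 / ((n : ℂ) + 1))
      rwa [sub_add_cancel, norm_div, hn, norm_one] at this
    have h3 : 1 / ((n : ℝ) + 1) ≤ A * ‖z - 1 / ((n : ℂ) + 1)‖ / ((n : ℝ) + 1) := by gcongr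
    calc _ ≤ _ := h2
      _ ≤ ‖z - 1 / ((n : ℂ) + 1)‖ + A * ‖z - 1 / ((n : ℂ) + 1)‖ / ((n : ℝ) + 1) := by gcongr
      _ = _ := by ring
  · nlinarith [Nat.cast_nonneg (α := ℝ) n, mul_nonneg (Nat.cast_nonneg (α := ℝ) n) (zero_le_one.trans h1)]

/-- Off the points `1 / n`, the resolvent of the Cesàro operator has polynomially bounded entries. -/
theorem exists_norm_le_of_resolvent {z : ℂ} (hz : ∀ n : ℕ, z ≠ 1 / ((n : ℂ) + 1)) :
    ∃ (B : ℝ) (D : ℕ), 0 ≤ B ∧ ∀ x y : ℕ → ℂ, (∀ n, z * x n - cesaroSeq x n = y n) →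
      ∀ n : ℕ, ‖x n‖ ≤ B * ((n : ℝ) + 1) ^ D * ∑ i ∈ Finset.range (n + 1), ‖y i‖ := by
  obtain ⟨A, hA⟩ := exists_resolvent_bound hz
  -- `x n` is a difference of two partial sums, each bounded with `2 (n + 1)` in place of the base
  -- in `hS`.
  refine ⟨2 * A * 2 ^ (A + 1), A + 1, by positivity, fun x y hxy => ?_⟩
  -- A discrete Gronwall estimate: the growth factors `1 + A/(n+1)` multiply up to the power `A`,
  -- and the extra power pays for dividing `y n` by `z - 1/(n+1)`.
  have hS (n : ℕ) : ‖∑ i ∈ Finset.range n, x i‖ ≤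
      A * ((n : ℝ) + 1) ^ (A + 1) * ∑ i ∈ Finset.range n, ‖y i‖ := by
    induction n with
    | zero => simp
    | succ n ih =>
      obtain ⟨h1, h2⟩ := hA n
      have hpos : 0 < ‖z - 1 / ((n : ℂ) + 1)‖ := norm_pos_iff.2 (sub_ne_zero.2 (hz n))
      have hrec := smul_sub_cesaroSeq_apply z x n
      rw [hxy, eq_sub_iff_add_eq, eq_comm] at hrec
      have h3 := norm_add_le (y n) (z * ∑ i ∈ Finset.range n, x i)
      rw [← hrec, norm_mul, norm_mul] at h3
      have hn : (0 : ℝ) < n + 1 := by positivity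
      -- Bernoulli's inequality replaces the growth factor by a ratio of consecutive values of
      -- `(n+1)^A`, which telescopes.
      have hbern : 1 + A / ((n : ℝ) + 1) ≤ (((n : ℝ) + 2) / (n + 1)) ^ A := by
        have := one_add_mul_le_pow (a := 1 / ((n : ℝ) + 1))
          ((by norm_num : (-2 : ℝ) ≤ 0).trans (by positivity)) A
        rw [mul_one_div] at this
        refine this.trans_eq ?_
        congr 1
        field_simp
        ring
      rw [Finset.sum_range_succ (fun i => ‖y i‖)]
      set Y := ∑ i ∈ Finset.range n, ‖y i‖
      have hY : 0 ≤ Y := Finset.sum_nonneg fun _ _ => norm_nonneg _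
      set d := ‖z - 1 / ((n : ℂ) + 1)‖
      refine le_of_mul_le_mul_left (h3.trans ?_) hpos
      have h4 : ‖y n‖ ≤ d * (A * ((n : ℝ) + 2) ^ (A + 1) * ‖y n‖) := by
        have h5 : 1 ≤ A * ((n : ℝ) + 2) ^ (A + 1) * d :=
          h2.trans <| by
            gcongr
            calc (n : ℝ) + 1 ≤ n + 2 := by linarith
              _ ≤ _ := le_self_pow₀ (by linarith) (by omega)
        nlinarith [norm_nonneg (y n)]
      have h6 : ‖z‖ * ‖∑ i ∈ Finset.range n, x i‖ ≤ d * (A * ((n : ℝ) + 2) ^ (A + 1) * Y) :=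
        calc _ ≤ ((((n : ℝ) + 2) / (n + 1)) ^ A * d) * (A * ((n : ℝ) + 1) ^ (A + 1) * Y) := by
              gcongr
              exact h1.trans (by gcongr)
          _ = d * (A * (((n : ℝ) + 2) ^ A * (n + 1)) * Y) := by
              rw [div_pow, pow_succ]; field_simp
          _ ≤ d * (A * (((n : ℝ) + 2) ^ A * (n + 2)) * Y) := by gcongr; norm_num
          _ = _ := by ring
      push_cast
      rw [add_assoc, one_add_one_eq_two]
      linarith
  intro n
  have h1 := hS n
  have h2 := hS (n + 1)
  have hx : x n = ∑ i ∈ Finset.range (n + 1), x i - ∑ i ∈ Finset.range n, x i := by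
    rw [Finset.sum_range_succ]; ring
  rw [hx]
  refine (norm_sub_le _ _).trans ?_
  have hYn : ∑ i ∈ Finset.range n, ‖y i‖ ≤ ∑ i ∈ Finset.range (n + 1), ‖y i‖ := by
    rw [Finset.sum_range_succ]; linarith [norm_nonneg (y n)]
  set Y := ∑ i ∈ Finset.range (n + 1), ‖y i‖
  have hY : 0 ≤ Y := Finset.sum_nonneg fun _ _ => norm_nonneg _
  have h3 : A * (((n + 1 : ℕ) : ℝ) + 1) ^ (A + 1) * Y ≤ A * (2 * ((n : ℝ) + 1)) ^ (A + 1) * Y := by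
    gcongr
    push_cast
    linarith [Nat.cast_nonneg (α := ℝ) n]
  have h4 : A * ((n : ℝ) + 1) ^ (A + 1) * ∑ i ∈ Finset.range n, ‖y i‖ ≤
      A * (2 * ((n : ℝ) + 1)) ^ (A + 1) * Y := by
    gcongr
    linarith [Nat.cast_nonneg (α := ℝ) n]
  rw [mul_pow] at h3 h4
  linarith

theorem exists_resolvent_eq {z : ℂ} (hz : ∀ n : ℕ, z ≠ 1 / ((n : ℂ) + 1)) (y : ℕ → ℂ) :
    ∃ x : ℕ → ℂ, ∀ n, z * x n - cesaroSeq x n = y n := by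
  -- The recurrence is solved for the partial sums, starting from the empty sum `0`.
  let S : ℕ → ℂ := fun n => Nat.rec 0 (fun n a => (y n + z * a) / (z - 1 / ((n : ℂ) + 1))) n
  have hS (n : ℕ) : ∑ i ∈ Finset.range n, (S (i + 1) - S i) = S n := by
    rw [Finset.sum_range_sub]; exact sub_zero _
  refine ⟨fun n => S (n + 1) - S n, fun n => ?_⟩
  refine (smul_sub_cesaroSeq_apply z (fun n => S (n + 1) - S n) n).trans ?_
  rw [hS, hS]
  have : S (n + 1) = (y n + z * S n) / (z - 1 / ((n : ℂ) + 1)) := rfl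
  rw [this, mul_div_cancel₀ _ (sub_ne_zero.2 (hz n))]
  ring

/-! ### Spectra of the Cesàro operator on `E_α` -/

namespace CoechelonSpace

variable {α s : ℕ → ℝ} (hα : StrictMono α) (hs : ∀ k, 1 < s k)

theorem toSeq_smul_sub_cesaro (z : ℂ) (x : CoechelonSpace α s) (n : ℕ) :
    toSeq α s ((z • (1 : CoechelonSpace α s →L[ℂ] CoechelonSpace α s) - cesaro hα hs) x) n =
      z * toSeq α s x n - cesaroSeq (toSeq α s x) n := rfl

theorem mem_spectrum_cesaro_iff (z : ℂ) : z ∈ spectrum ℂ (cesaro hα hs) ↔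
    ¬ IsUnit (z • (1 : CoechelonSpace α s →L[ℂ] CoechelonSpace α s) - cesaro hα hs) := by
  rw [spectrum.mem_iff, Algebra.algebraMap_eq_smul_one]

theorem surjective_of_notMem_spectrum {z : ℂ} (hz : z ∉ spectrum ℂ (cesaro hα hs)) :
    Function.Surjective (z • (1 : CoechelonSpace α s →L[ℂ] CoechelonSpace α s) - cesaro hα hs) := by
  rw [mem_spectrum_cesaro_iff, not_not] at hz
  obtain ⟨T, hT, -⟩ := isUnit_iff_exists.1 hz
  exact fun y => ⟨T y, DFunLike.congr_fun hT y⟩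

theorem mem_pointSpectrum_cesaro_iff (z : ℂ) : z ∈ pointSpectrum (cesaro hα hs) ↔
    ∃ x : CoechelonSpace α s, x ≠ 0 ∧ ∀ n, z * toSeq α s x n = cesaroSeq (toSeq α s x) n := by
  change ¬ Function.Injective _ ↔ _
  rw [injective_iff_map_eq_zero]
  push Not
  refine exists_congr fun x => and_comm.trans (and_congr_right fun _ => ?_)
  refine ⟨fun h n => ?_, fun h => ext fun n => ?_⟩
  · rw [← sub_eq_zero, ← toSeq_smul_sub_cesaro hα hs, h]; rfl
  · rw [toSeq_smul_sub_cesaro, h, sub_self]; rfl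

theorem exists_toSeq_eq_single (n : ℕ) :
    ∃ x : CoechelonSpace α s, toSeq α s x = Pi.single n 1 := by
  refine exists_toSeq_eq (k := 0) (tendsto_const_nhds.congr' ?_)
  filter_upwards [eventually_gt_atTop n] with m hm
  rw [Pi.single_eq_of_ne hm.ne', smul_zero]

/-- The matrix of `z - C` is lower triangular with a zero at diagonal entry `N`, so the unit vector
`e_N` is not in its range: the partial sums of a preimage vanish up to `N`, and row `N` then reads
`0 = 1`. -/
theorem one_div_mem_spectrum (N : ℕ) : 1 / ((N : ℂ) + 1) ∈ spectrum ℂ (cesaro hα hs) := by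
  by_contra hN
  obtain ⟨e, he⟩ := exists_toSeq_eq_single (α := α) (s := s) N
  obtain ⟨x, hx⟩ := surjective_of_notMem_spectrum hα hs hN e
  have h (n : ℕ) := toSeq_smul_sub_cesaro hα hs (1 / ((N : ℂ) + 1)) x n
  simp only [hx, he, smul_sub_cesaroSeq_apply] at h
  have hS : ∀ n ≤ N, ∑ i ∈ Finset.range n, toSeq α s x i = 0 := by
    intro n
    induction n with
    | zero => simp
    | succ n ih =>
      intro hn
      have := h n
      rw [ih (by omega), Pi.single_eq_of_ne (by omega), mul_zero, sub_zero, eq_comm,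
        mul_eq_zero] at this
      refine this.resolve_left fun h0 => ?_
      rw [sub_eq_zero, one_div, one_div, inv_inj, add_left_inj, Nat.cast_inj] at h0
      omega
  have := h N
  rw [hS N le_rfl] at this
  simp at this

theorem pointSpectrum_subset {z : ℂ} (hz : z ∈ pointSpectrum (cesaro hα hs)) :
    ∃ n : ℕ, z = 1 / ((n : ℂ) + 1) := by
  by_contra! hne
  obtain ⟨x, hx0, hx⟩ := (mem_pointSpectrum_cesaro_iff hα hs z).1 hz
  obtain ⟨B, D, -, hB⟩ := exists_norm_le_of_resolvent hne
  refine hx0 (ext fun n => ?_)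
  simpa using hB (toSeq α s x) 0 (fun n => sub_eq_zero.2 (hx n)) n

/-- The recurrence at `z = 1/2` leaves only the multiples of `(0, 1, 2, 3, …)` as eigensequences. -/
theorem hasLogGrowth_of_one_half_mem_pointSpectrum (hα_pos : ∀ n, 0 < α n) (hs_mono : StrictMono s)
    (h : (1 / 2 : ℂ) ∈ pointSpectrum (cesaro hα hs)) : HasLogGrowth α s := by
  obtain ⟨x, hx0, hx⟩ := (mem_pointSpectrum_cesaro_iff hα hs _).1 h
  have hrec (n : ℕ) := smul_sub_cesaroSeq_apply (1 / 2) (toSeq α s x) n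
  simp only [sub_eq_zero.2 (hx _)] at hrec
  have h0 : toSeq α s x 0 = 0 := by
    have := hrec 0
    norm_num at this
    exact this
  set a := toSeq α s x 1
  have hS (n : ℕ) : ∑ i ∈ Finset.range (n + 1), toSeq α s x i = a * (n * (n + 1) / 2) := by
    induction n with
    | zero => simp [h0]
    | succ n ih =>
      -- Row `1` has coefficient `1/2 - 1/2 = 0` and determines nothing: `x 1 = a` is the free
      -- parameter.
      obtain rfl | hn := Nat.eq_zero_or_pos n
      · simp [Finset.sum_range_succ, h0, a]
      have := hrec (n + 1)
      rw [ih] at this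
      have hn0 : (n : ℂ) ≠ 0 := Nat.cast_ne_zero.2 hn.ne'
      have hn2 : (n : ℂ) + 1 + 1 ≠ 0 := by exact_mod_cast (n + 1).succ_ne_zero
      push_cast at this ⊢
      refine mul_left_cancel₀ hn0 ?_
      field_simp at this
      linear_combination (-1 / 2 : ℂ) * this
  have hxn (n : ℕ) : toSeq α s x (n + 1) = a * (n + 1) := by
    have := Finset.sum_range_succ (toSeq α s x) (n + 1)
    rw [hS, hS] at this
    push_cast at this
    linear_combination -this
  have ha : a ≠ 0 := by
    rintro ha
    refine hx0 (ext fun n => ?_)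
    cases n with
    | zero => exact h0
    | succ n => rw [hxn, ha, zero_mul]; rfl
  refine hasLogGrowth_of_linear_le hα_pos hs_mono hs x (norm_pos_iff.2 ha) fun n => ?_
  rw [hxn, norm_mul, ← Nat.cast_add_one, ← Nat.cast_add_one, Complex.norm_natCast]

/-- Since `v_0 → 0`, the bounded sequence `(-1)^n` lies in `E_α`. Inverting `-C` multiplies by `n +
1` and takes differences, which add up in modulus because the signs alternate. -/
theorem hasLogGrowth_of_zero_notMem_spectrum (hα_pos : ∀ n, 0 < α n)
    (hα_top : Tendsto α atTop atTop) (hs_mono : StrictMono s)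
    (h : (0 : ℂ) ∉ spectrum ℂ (cesaro hα hs)) : HasLogGrowth α s := by
  have hy : Tendsto (fun n => coechelonWeight α s 0 n • (-1 : ℂ) ^ n) atTop (𝓝 0) := by
    have : Tendsto (coechelonWeight α s 0) atTop (𝓝 0) :=
      (tendsto_rpow_atBot_of_base_gt_one _ (hs 0)).comp (tendsto_neg_atTop_atBot.comp hα_top)
    refine squeeze_zero_norm (fun n => ?_) this
    rw [norm_smul, norm_pow, norm_neg, norm_one, one_pow, mul_one,
      Real.norm_of_nonneg (coechelonWeight_nonneg hs 0 n)]
  obtain ⟨y, hy⟩ := exists_toSeq_eq hy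
  obtain ⟨x, hx⟩ := surjective_of_notMem_spectrum hα hs h y
  have hS (n : ℕ) : ∑ i ∈ Finset.range (n + 1), toSeq α s x i = -((n + 1) * (-1) ^ n) := by
    have := toSeq_smul_sub_cesaro hα hs 0 x n
    rw [hx, hy, smul_sub_cesaroSeq_apply] at this
    have hn : (n : ℂ) + 1 ≠ 0 := by exact_mod_cast n.succ_ne_zero
    field_simp at this
    linear_combination this
  refine hasLogGrowth_of_linear_le hα_pos hs_mono hs x one_pos fun n => ?_
  have hxn : toSeq α s x (n + 1) = ((2 * n + 3 : ℕ) : ℂ) * (-1) ^ n := by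
    have := Finset.sum_range_succ (toSeq α s x) (n + 1)
    rw [hS, hS] at this
    push_cast at this ⊢
    linear_combination -this
  rw [hxn, norm_mul, Complex.norm_natCast, norm_pow, norm_neg, norm_one, one_pow]
  push_cast
  linarith [Nat.cast_nonneg (α := ℝ) n]

/-- The eigensequence is `n.choose N`: the hockey-stick identity evaluates its partial sums, and its
growth is polynomial of degree `N`. -/
theorem one_div_mem_pointSpectrum (h : HasLogGrowth α s) (hα_pos : ∀ n, 0 < α n)
    (hs_mono : StrictMono s) (hs_top : Tendsto s atTop atTop) (N : ℕ) :
    1 / ((N : ℂ) + 1) ∈ pointSpectrum (cesaro hα hs) := by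
  obtain ⟨e, he⟩ := exists_toSeq_eq_single (α := α) (s := s) 0
  -- Comparison with `e_0`, all of whose nonempty partial sums are `1`, expresses plain polynomial
  -- growth.
  obtain ⟨x, hx⟩ := exists_toSeq_eq_of_partialSum_le (z := fun n => (n.choose N : ℂ)) (D := N)
    (B := 1) h hα_pos hα hs hs_mono hs_top e zero_le_one fun n => by
      rw [Finset.sum_range_succ', he, Complex.norm_natCast]
      simp only [Pi.single_eq_of_ne (Nat.succ_ne_zero _), Pi.single_eq_same]
      simp only [norm_zero, Finset.sum_const_zero, zero_add, norm_one, one_mul, mul_one]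
      exact_mod_cast (Nat.choose_le_pow n N).trans (Nat.pow_le_pow_left n.le_succ N)
  refine (mem_pointSpectrum_cesaro_iff hα hs _).2 ⟨x, fun h0 => ?_, fun n => ?_⟩
  · have : toSeq α s x N = 0 := by rw [h0]; rfl
    simp [hx] at this
  · have hsum : ∑ i ∈ Finset.range (n + 1), i.choose N = (n + 1).choose (N + 1) := by
      rw [← Nat.sum_Icc_choose]
      refine (Finset.sum_subset (fun i hi => ?_) fun i hi hi' => ?_).symm
      · simp only [Finset.mem_Icc, Finset.mem_range] at hi ⊢; omega
      · simp only [Finset.mem_Icc, Finset.mem_range] at hi hi'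
        exact Nat.choose_eq_zero_of_lt (by omega)
    have hc : cesaroSeq (toSeq α s x) n = ((n + 1).choose (N + 1) : ℂ) / ((n : ℂ) + 1) := by
      rw [← hsum, hx]; push_cast; rfl
    have hchoose : ((n : ℂ) + 1) * n.choose N = (n + 1).choose (N + 1) * (N + 1) := by
      exact_mod_cast Nat.add_one_mul_choose_eq n N
    have hn : (n : ℂ) + 1 ≠ 0 := by exact_mod_cast n.succ_ne_zero
    have hN : (N : ℂ) + 1 ≠ 0 := by exact_mod_cast N.succ_ne_zero
    rw [hc, hx]
    field_simp
    linear_combination hchoose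

/-- The bound on resolvent entries gives injectivity, membership of the formal solution in `E_α`,
and continuity of the inverse. -/
theorem notMem_spectrum (h : HasLogGrowth α s) (hα_pos : ∀ n, 0 < α n)
    (hs_mono : StrictMono s) (hs_top : Tendsto s atTop atTop) {z : ℂ}
    (hz : ∀ n : ℕ, z ≠ 1 / ((n : ℂ) + 1)) : z ∉ spectrum ℂ (cesaro hα hs) := by
  rw [mem_spectrum_cesaro_iff, not_not]
  obtain ⟨B, D, hB0, hB⟩ := exists_norm_le_of_resolvent hz
  set T := z • (1 : CoechelonSpace α s →L[ℂ] CoechelonSpace α s) - cesaro hα hs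
  have hinj : Function.Injective T := by
    by_contra hninj
    obtain ⟨n, hn⟩ := pointSpectrum_subset hα hs hninj
    exact hz n hn
  have hsurj : Function.Surjective T := by
    intro y
    obtain ⟨x, hx⟩ := exists_resolvent_eq hz (toSeq α s y)
    obtain ⟨x, rfl⟩ := exists_toSeq_eq_of_partialSum_le h hα_pos hα hs hs_mono hs_top y hB0
      (hB x _ hx)
    exact ⟨x, ext hx⟩
  let e := LinearEquiv.ofBijective (T : CoechelonSpace α s →ₗ[ℂ] CoechelonSpace α s)
    ⟨hinj, hsurj⟩
  have he (y) : T (e.symm y) = y := e.apply_symm_apply y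
  have hcont : Continuous e.symm.toLinearMap := by
    refine continuous_of_partialSum_le (D := D) h hα_pos hα hs hs_top _ hB0 fun y => ?_
    refine hB _ _ fun n => ?_
    rw [← toSeq_smul_sub_cesaro hα hs]
    exact congrArg (fun x => toSeq α s x n) (he y)
  refine isUnit_iff_exists.2 ⟨⟨e.symm.toLinearMap, hcont⟩, ?_, ?_⟩
  · exact ContinuousLinearMap.ext he
  · exact ContinuousLinearMap.ext fun x => e.symm_apply_apply x

end CoechelonSpace

namespace CoechelonSpace

variable {α s : ℕ → ℝ}

/-! ### Continuous seminorms on `E_α` -/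

/-- The universal property is applied to the identity map into `(E_α, q)`. -/
theorem continuous_seminorm_of_steps (q : Seminorm ℂ (CoechelonSpace α s))
    (hq : ∀ k, ∃ C : ℝ, ∀ x : WeightedC0 (coechelonWeight α s k), q (incl α s k x) ≤ C * ‖x‖) :
    Continuous q := by
  let f : CoechelonSpace α s →ₗ[ℂ] SeminormSpace q := ⟨⟨id, fun _ _ => rfl⟩, fun _ _ => rfl⟩
  have hf : Continuous f := by
    refine inductiveTopology_continuous_of_steps (incl α s) f fun k => ?_
    obtain ⟨C, hC⟩ := hq k
    exact AddMonoidHomClass.continuous_of_bound (f ∘ₗ incl α s k) C hC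
  exact continuous_norm.comp hf

theorem exists_seminorm_le_norm {p : Seminorm ℂ (CoechelonSpace α s)} (hp : Continuous p) (k : ℕ) :
    ∃ C : ℝ, 0 < C ∧ ∀ x : WeightedC0 (coechelonWeight α s k), p (incl α s k x) ≤ C * ‖x‖ :=
  Seminorm.bound_of_continuous_normedSpace (p.comp (incl α s k))
    (hp.comp (inductiveTopology_continuous_incl (incl α s) k))

theorem weight_mul_norm_le (hs : ∀ k, 1 < s k) {k : ℕ} {w : ℕ → ℝ} {C : ℝ}
    {n : ℕ} (hw : w n ≤ C * coechelonWeight α s k n) (hC : 0 ≤ C)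
    (x : WeightedC0 (coechelonWeight α s k)) : w n * ‖toSeq α s (incl α s k x) n‖ ≤ C * ‖x‖ := by
  have h := WeightedC0.le_norm _ x n
  rw [norm_smul, Real.norm_of_nonneg (coechelonWeight_nonneg hs k n)] at h
  calc _ ≤ C * coechelonWeight α s k n * ‖toSeq α s (incl α s k x) n‖ := by gcongr
    _ = C * (coechelonWeight α s k n * ‖toSeq α s (incl α s k x) n‖) := by ring
    _ ≤ _ := by gcongr; exact h

/-- The weights of the continuous weighted supremum seminorms on `E_α`. -/
def IsDominated (α s w : ℕ → ℝ) : Prop :=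
  ∀ k, ∃ C : ℝ, 0 ≤ C ∧ ∀ n, w n ≤ C * coechelonWeight α s k n

theorem IsDominated.bddAbove (hα : ∀ n, 0 < α n) (hs : ∀ k, 1 < s k) (hs_mono : StrictMono s)
    {w : ℕ → ℝ} (hw : IsDominated α s w) (x : CoechelonSpace α s) :
    BddAbove (Set.range fun n => w n * ‖toSeq α s x n‖) := by
  obtain ⟨k, x, rfl⟩ := exists_incl_eq hα hs_mono hs x
  obtain ⟨C, hC0, hC⟩ := hw k
  exact ⟨C * ‖x‖, by rintro _ ⟨n, rfl⟩; exact weight_mul_norm_le hs (hC n) hC0 x⟩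

theorem exists_continuous_sup_seminorm (hα : ∀ n, 0 < α n) (hs : ∀ k, 1 < s k)
    (hs_mono : StrictMono s) {w : ℕ → ℝ} (hw0 : ∀ n, 0 ≤ w n) (hw : IsDominated α s w) :
    ∃ p : Seminorm ℂ (CoechelonSpace α s), Continuous p ∧
      ∀ x n, w n * ‖toSeq α s x n‖ ≤ p x := by
  have hb := hw.bddAbove hα hs hs_mono
  let p : Seminorm ℂ (CoechelonSpace α s) := Seminorm.of
    (fun x => ⨆ n, w n * ‖toSeq α s x n‖)
    (fun x y => ciSup_le fun n => by
      rw [map_add, Pi.add_apply]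
      calc w n * ‖toSeq α s x n + toSeq α s y n‖
          ≤ w n * ‖toSeq α s x n‖ + w n * ‖toSeq α s y n‖ := by
            rw [← mul_add]; exact mul_le_mul_of_nonneg_left (norm_add_le _ _) (hw0 n)
        _ ≤ _ := add_le_add (le_ciSup (hb x) n) (le_ciSup (hb y) n))
    (fun c x => by
      rw [Real.mul_iSup_of_nonneg (norm_nonneg c)]
      congr 1
      ext n
      rw [map_smul, Pi.smul_apply, norm_smul]
      ring)
  refine ⟨p, continuous_seminorm_of_steps p fun k => ?_, fun x n => le_ciSup (hb x) n⟩
  obtain ⟨C, hC0, hC⟩ := hw k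
  exact ⟨C, fun x => ciSup_le fun n => weight_mul_norm_le hs (hC n) hC0 x⟩

theorem weight_mul_norm_le_div (hs : ∀ k, 1 < s k) {k : ℕ} {w : ℕ → ℝ} {C : ℝ}
    {n : ℕ} (hw : ((n : ℝ) + 1) ^ 2 * w n ≤ C * coechelonWeight α s k n) (hC : 0 ≤ C)
    (x : WeightedC0 (coechelonWeight α s k)) :
    w n * ‖toSeq α s (incl α s k x) n‖ ≤ C * ‖x‖ * (1 / ((n : ℝ) + 1) ^ 2) := by
  rw [mul_one_div, le_div_iff₀ (by positivity)]
  have := weight_mul_norm_le hs (w := fun n : ℕ => ((n : ℝ) + 1) ^ 2 * w n) hw hC x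
  linarith

theorem summable_one_div_add_one_sq : Summable fun n : ℕ => 1 / ((n : ℝ) + 1) ^ 2 := by
  have := (summable_nat_add_iff 1).2 (Real.summable_one_div_nat_pow.2 one_lt_two)
  simpa using this

theorem IsDominated.summable (hα : ∀ n, 0 < α n) (hs : ∀ k, 1 < s k) (hs_mono : StrictMono s)
    {w : ℕ → ℝ} (hw0 : ∀ n, 0 ≤ w n) (hw : IsDominated α s fun n => ((n : ℝ) + 1) ^ 2 * w n)
    (x : CoechelonSpace α s) : Summable fun n => w n * ‖toSeq α s x n‖ := by
  obtain ⟨k, x, rfl⟩ := exists_incl_eq hα hs_mono hs x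
  obtain ⟨C, hC0, hC⟩ := hw k
  exact Summable.of_nonneg_of_le (fun n => mul_nonneg (hw0 n) (norm_nonneg _))
    (fun n => weight_mul_norm_le_div hs (hC n) hC0 x) (summable_one_div_add_one_sq.mul_left _)

/-- The spare factor `(n+1)^2` bounds the series on each step by `‖x‖ ∑ 1/(n+1)^2`, up to a
constant. -/
theorem exists_continuous_l1_seminorm (hα : ∀ n, 0 < α n) (hs : ∀ k, 1 < s k)
    (hs_mono : StrictMono s) {w : ℕ → ℝ} (hw0 : ∀ n, 0 ≤ w n)
    (hw : IsDominated α s fun n => ((n : ℝ) + 1) ^ 2 * w n) :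
    ∃ q : Seminorm ℂ (CoechelonSpace α s), Continuous q ∧
      ∀ x, q x = ∑' n, w n * ‖toSeq α s x n‖ := by
  have hb := IsDominated.summable hα hs hs_mono hw0 hw
  let q : Seminorm ℂ (CoechelonSpace α s) := Seminorm.of
    (fun x => ∑' n, w n * ‖toSeq α s x n‖)
    (fun x y => by
      rw [← (hb x).tsum_add (hb y)]
      refine (hb (x + y)).tsum_le_tsum (fun n => ?_) ((hb x).add (hb y))
      rw [map_add, Pi.add_apply, ← mul_add]
      exact mul_le_mul_of_nonneg_left (norm_add_le _ _) (hw0 n))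
    (fun c x => by
      rw [← tsum_mul_left]
      congr 1
      ext n
      rw [map_smul, Pi.smul_apply, norm_smul]
      ring)
  refine ⟨q, continuous_seminorm_of_steps q fun k => ?_, fun x => rfl⟩
  obtain ⟨C, hC0, hC⟩ := hw k
  refine ⟨C * ∑' n : ℕ, 1 / ((n : ℝ) + 1) ^ 2, fun x => ?_⟩
  calc q (incl α s k x) ≤ ∑' n : ℕ, C * ‖x‖ * (1 / ((n : ℝ) + 1) ^ 2) :=
        (hb _).tsum_le_tsum (fun n => weight_mul_norm_le_div hs (hC n) hC0 x)
          (summable_one_div_add_one_sq.mul_left _)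
    _ = _ := by rw [tsum_mul_left]; ring

/-! ### Unit vectors -/

/-- The `n`-th unit vector of `E_α`. -/
noncomputable def unitVec (α s : ℕ → ℝ) (n : ℕ) : CoechelonSpace α s :=
  (exists_toSeq_eq_single n).choose

theorem toSeq_unitVec (n : ℕ) : toSeq α s (unitVec α s n) = Pi.single n 1 :=
  (exists_toSeq_eq_single n).choose_spec

theorem toSeq_sum_unitVec (c : ℕ → ℂ) (F : Finset ℕ) (m : ℕ) [Decidable (m ∈ F)] :
    toSeq α s (∑ n ∈ F, c n • unitVec α s n) m = if m ∈ F then c m else 0 := by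
  classical
  simp only [map_sum, map_smul, toSeq_unitVec, Finset.sum_apply, Pi.smul_apply, Pi.single_apply,
    smul_eq_mul, mul_ite, mul_one, mul_zero, Finset.sum_ite_eq]
  split_ifs <;> rfl

theorem seminorm_le_of_norm_le (hs : ∀ k, 1 < s k) {p : Seminorm ℂ (CoechelonSpace α s)} {k : ℕ}
    {C : ℝ} (hC0 : 0 ≤ C)
    (hC : ∀ x : WeightedC0 (coechelonWeight α s k), p (incl α s k x) ≤ C * ‖x‖)
    {x : CoechelonSpace α s}
    (hx : Tendsto (fun n => coechelonWeight α s k n • toSeq α s x n) atTop (𝓝 0)) {r : ℝ}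
    (hr : ∀ n, coechelonWeight α s k n * ‖toSeq α s x n‖ ≤ r) : p x ≤ C * r := by
  let y : WeightedC0 (coechelonWeight α s k) := ⟨toSeq α s x, hx⟩
  refine (hC y).trans (mul_le_mul_of_nonneg_left (ciSup_le fun n => ?_) hC0)
  rw [norm_smul, Real.norm_of_nonneg (coechelonWeight_nonneg hs k n)]
  exact hr n

theorem tendsto_weight_sum_unitVec (k : ℕ) (c : ℕ → ℂ) (F : Finset ℕ) :
    Tendsto (fun n => coechelonWeight α s k n • toSeq α s (∑ n ∈ F, c n • unitVec α s n) n)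
      atTop (𝓝 0) := by
  refine tendsto_const_nhds.congr' ?_
  obtain ⟨N, hN⟩ := F.exists_nat_subset_range
  filter_upwards [eventually_ge_atTop N] with m hm
  rw [toSeq_sum_unitVec, if_neg, smul_zero]
  exact fun h => absurd (Finset.mem_range.1 (hN h)) (by omega)

theorem isDominated_seminorm_unitVec (hs : ∀ k, 1 < s k) {p : Seminorm ℂ (CoechelonSpace α s)}
    (hp : Continuous p) : IsDominated α s fun n => p (unitVec α s n) := by
  intro k
  obtain ⟨C, hC0, hC⟩ := exists_seminorm_le_norm hp k
  refine ⟨C, hC0.le, fun n => ?_⟩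
  have hx := tendsto_weight_sum_unitVec (α := α) (s := s) k (fun _ => 1) {n}
  simp only [Finset.sum_singleton, one_smul] at hx
  refine seminorm_le_of_norm_le hs hC0.le hC hx fun m => ?_
  rw [toSeq_unitVec]
  obtain rfl | hm := eq_or_ne m n
  · simp
  · rw [Pi.single_eq_of_ne hm, norm_zero, mul_zero]
    exact coechelonWeight_nonneg hs k n

/-- The unit vectors form a basis: for `x` in the step `c₀(v_k)` the tails tend to `0` already in
the norm of that step. -/
theorem tendsto_seminorm_sub_sum (hα : ∀ n, 0 < α n) (hs : ∀ k, 1 < s k) (hs_mono : StrictMono s)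
    {p : Seminorm ℂ (CoechelonSpace α s)} (hp : Continuous p) (x : CoechelonSpace α s) :
    Tendsto (fun N => p (∑ n ∈ Finset.range N, toSeq α s x n • unitVec α s n - x))
      atTop (𝓝 0) := by
  obtain ⟨k, hk⟩ := (mem_coechelonSubmodule_iff hα hs_mono hs _).1 x.2
  change Tendsto (fun n => coechelonWeight α s k n • toSeq α s x n) atTop (𝓝 0) at hk
  obtain ⟨C, hC0, hC⟩ := exists_seminorm_le_norm hp k
  rw [Metric.tendsto_atTop]
  intro ε hε
  obtain ⟨N, hN⟩ := Metric.tendsto_atTop.1 hk (ε / (2 * C)) (by positivity)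
  refine ⟨N, fun M hM => ?_⟩
  rw [Real.dist_0_eq_abs, abs_of_nonneg (apply_nonneg p _)]
  have hx : p (∑ n ∈ Finset.range M, toSeq α s x n • unitVec α s n - x) ≤ C * (ε / (2 * C)) := by
    refine seminorm_le_of_norm_le hs hC0.le hC ?_ fun m => ?_
    · simpa [smul_sub] using (tendsto_weight_sum_unitVec k (toSeq α s x) (Finset.range M)).sub hk
    · rw [map_sub, Pi.sub_apply, toSeq_sum_unitVec]
      split_ifs with hm
      · rw [sub_self, norm_zero, mul_zero]; positivity
      · have := hN m (hM.trans (not_lt.1 (Finset.mem_range.not.1 hm)))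
        rw [dist_zero_right, norm_smul,
          Real.norm_of_nonneg (coechelonWeight_nonneg hs k m)] at this
        rw [zero_sub, norm_neg]
        exact this.le
  refine hx.trans_lt ?_
  field_simp
  linarith

end CoechelonSpace

/-! ### Dominated weights and basis expansions -/

theorem exists_forall_le_of_eventually_le_one {f : ℕ → ℝ} (h : ∀ᶠ n in atTop, f n ≤ 1) :
    ∃ C : ℝ, 0 ≤ C ∧ ∀ n, f n ≤ C := by
  obtain ⟨C, hC⟩ := (show IsBoundedUnder (· ≤ ·) atTop f from ⟨1, h⟩).bddAbove_range
  exact ⟨max C 0, le_max_right _ _, fun n => (hC ⟨n, rfl⟩).trans (le_max_left _ _)⟩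

namespace CoechelonSpace

variable {α s : ℕ → ℝ}

theorem isDominated_of_eventually_le (hs : ∀ k, 1 < s k) {w : ℕ → ℝ}
    (h : ∀ k, ∀ᶠ n in atTop, w n ≤ coechelonWeight α s k n) : IsDominated α s w := by
  intro k
  have hpos := coechelonWeight_pos (α := α) hs k
  obtain ⟨C, hC0, hC⟩ := exists_forall_le_of_eventually_le_one
    ((h k).mono fun n hn => (div_le_one (hpos n)).2 hn)
  exact ⟨C, hC0, fun n => (div_le_iff₀ (hpos n)).1 (hC n)⟩

theorem IsDominated.pow_mul {w : ℕ → ℝ} (hw : IsDominated α s w) (h : HasLogGrowth α s)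
    (hα : ∀ n, 0 < α n) (hs : ∀ k, 1 < s k) (hs_top : Tendsto s atTop atTop) (d : ℕ) :
    IsDominated α s fun n => ((n : ℝ) + 1) ^ d * w n := by
  intro k
  obtain ⟨l, C, hC0, hC⟩ := h.exists_pow_mul_le hα hs hs_top d k
  obtain ⟨B, hB0, hB⟩ := hw l
  refine ⟨B * C, by positivity, fun n => ?_⟩
  calc ((n : ℝ) + 1) ^ d * w n ≤ ((n : ℝ) + 1) ^ d * (B * coechelonWeight α s l n) := by
        gcongr; exact hB n
    _ = B * (((n : ℝ) + 1) ^ d * coechelonWeight α s l n) := by ring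
    _ ≤ B * (C * coechelonWeight α s k n) := mul_le_mul_of_nonneg_left (hC n) hB0
    _ = _ := by ring

/-- There are strictly positive weights which are dominated by all the weights `v_k`. -/
theorem isDominated_diagonal (hα : ∀ n, 0 < α n) (hs : ∀ k, 1 < s k) (hs_mono : StrictMono s) :
    IsDominated α s fun n => coechelonWeight α s n n :=
  isDominated_of_eventually_le hs fun k => (eventually_ge_atTop k).mono fun n hn =>
    coechelonWeight_anti_left hα hs hs_mono n hn

theorem IsDominated.add {v w : ℕ → ℝ} (hv : IsDominated α s v) (hw : IsDominated α s w) :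
    IsDominated α s fun n => v n + w n := by
  intro k
  obtain ⟨B, hB0, hB⟩ := hv k
  obtain ⟨C, hC0, hC⟩ := hw k
  exact ⟨B + C, by positivity, fun n => (add_le_add (hB n) (hC n)).trans_eq (by ring)⟩

theorem seminorm_le_of_sum_le (hα : ∀ n, 0 < α n) (hs : ∀ k, 1 < s k) (hs_mono : StrictMono s)
    {p : Seminorm ℂ (CoechelonSpace α s)} (hp : Continuous p) {x : CoechelonSpace α s} {r : ℝ}
    (hr : ∀ N, ∑ n ∈ Finset.range N, p (unitVec α s n) * ‖toSeq α s x n‖ ≤ r) : p x ≤ r := by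
  have hlim := (tendsto_seminorm_sub_sum hα hs hs_mono hp x).add_const r
  rw [zero_add] at hlim
  refine ge_of_tendsto' hlim fun N => ?_
  set S := ∑ n ∈ Finset.range N, toSeq α s x n • unitVec α s n
  have hS : p S ≤ r := by
    refine (Finset.le_sum_of_subadditive p (map_zero p).le (map_add_le_add p) _ _).trans
      (le_trans (Finset.sum_le_sum fun n _ => ?_) (hr N))
    rw [map_smul_eq_mul, mul_comm]
  have : p x ≤ p (S - x) + p S := by
    have := map_sub_le_add p S (S - x)
    rw [sub_sub_cancel] at this
    linarith
  linarith

/-! ### Coordinates on the local Banach spaces -/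

/-- The canonical map from `E_α` to the local Banach space of `p`. -/
noncomputable def toLocalBanach (p : Seminorm ℂ (CoechelonSpace α s)) :
    CoechelonSpace α s →ₗ[ℂ] LocalBanachSpace p :=
  (UniformSpace.Completion.toComplL (𝕜 := ℂ) (E := SeminormSpace p)).toLinearMap ∘ₗ
    ⟨⟨id, fun _ _ => rfl⟩, fun _ _ => rfl⟩

theorem norm_toLocalBanach (p : Seminorm ℂ (CoechelonSpace α s)) (x : CoechelonSpace α s) :
    ‖toLocalBanach p x‖ = p x :=
  UniformSpace.Completion.norm_coe (E := SeminormSpace p) x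

theorem linkingMap_toLocalBanach {p q : Seminorm ℂ (CoechelonSpace α s)} (h : p ≤ q)
    (x : CoechelonSpace α s) : linkingMap h (toLocalBanach q x) = toLocalBanach p x :=
  (SeminormSpace.idMap h).completion_apply_coe x

/-- The `n`-th coordinate extends to a functional on the local Banach space of `p`. -/
theorem exists_coord {p : Seminorm ℂ (CoechelonSpace α s)} {n : ℕ} {B : ℝ} (hB : 0 ≤ B) (c : ℂ)
    (hp : ∀ x, ‖c * toSeq α s x n‖ ≤ B * p x) :
    ∃ f : LocalBanachSpace p →L[ℂ] ℂ, ‖f‖ ≤ B ∧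
      ∀ x, f (toLocalBanach p x) = c * toSeq α s x n := by
  let g : SeminormSpace p →ₗ[ℂ] ℂ :=
    ⟨⟨fun x => c * toSeq α s x n, fun x y => mul_add c (toSeq α s x n) (toSeq α s y n)⟩,
      fun a x => mul_left_comm c a (toSeq α s x n)⟩
  let f := (g.mkContinuous B hp).fromCompletion
  have hf (x : SeminormSpace p) : f (x : LocalBanachSpace p) = g x :=
    (g.mkContinuous B hp).fromCompletion_apply_coe x
  refine ⟨f, f.opNorm_le_bound hB fun x => ?_, hf⟩
  induction x using UniformSpace.Completion.induction_on with
  | hp => exact isClosed_le f.continuous.norm (continuous_const.mul continuous_norm)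
  | ih x =>
    rw [hf, UniformSpace.Completion.norm_coe]
    exact hp x

/-! ### Log growth implies nuclearity -/

theorem isNuclearSpace_of_hasLogGrowth (h : HasLogGrowth α s) (hα : ∀ n, 0 < α n)
    (hs : ∀ k, 1 < s k) (hs_mono : StrictMono s) (hs_top : Tendsto s atTop atTop) :
    IsNuclearSpace (CoechelonSpace α s) := by
  intro p hp
  -- The diagonal weight keeps `u` positive where `p` vanishes on a unit vector, so that `w` can be
  -- inverted.
  let u : ℕ → ℝ := fun n => p (unitVec α s n) + coechelonWeight α s n n
  have hu : IsDominated α s u :=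
    (isDominated_seminorm_unitVec hs hp).add (isDominated_diagonal hα hs hs_mono)
  have hpu (n : ℕ) : p (unitVec α s n) ≤ u n :=
    le_add_of_nonneg_right (coechelonWeight_nonneg hs n n)
  have hu0 (n : ℕ) : 0 < u n :=
    add_pos_of_nonneg_of_pos (apply_nonneg p _) (coechelonWeight_pos hs n n)
  let w : ℕ → ℝ := fun n => ((n : ℝ) + 1) ^ 2 * u n
  have hw0 (n : ℕ) : 0 < w n := mul_pos (by positivity) (hu0 n)
  have huw (n : ℕ) : u n ≤ w n := by
    refine le_mul_of_one_le_left (hu0 n).le (one_le_pow₀ ?_)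
    linarith [Nat.cast_nonneg (α := ℝ) n]
  -- One square is the gain of `w` over `u` that makes the representation nuclear; the other makes
  -- the `ℓ¹` seminorm finite.
  have hw : IsDominated α s fun n => ((n : ℝ) + 1) ^ 2 * w n :=
    (hu.pow_mul h hα hs hs_top 2).pow_mul h hα hs hs_top 2
  have hsum := IsDominated.summable hα hs hs_mono (fun n => (hw0 n).le) hw
  obtain ⟨q, hq, hqw⟩ :=
    exists_continuous_l1_seminorm hα hs hs_mono (fun n => (hw0 n).le) hw
  have hterm (x : CoechelonSpace α s) (n : ℕ) : 0 ≤ w n * ‖toSeq α s x n‖ :=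
    mul_nonneg (hw0 n).le (norm_nonneg _)
  have hpq : p ≤ q := by
    intro x
    refine seminorm_le_of_sum_le hα hs hs_mono hp fun N => ?_
    rw [hqw]
    refine le_trans (Finset.sum_le_sum fun n _ => ?_)
      ((hsum x).sum_le_tsum (Finset.range N) fun n _ => hterm x n)
    exact mul_le_mul_of_nonneg_right ((hpu n).trans (huw n)) (norm_nonneg _)
  have hcoord (n : ℕ) : ∃ f : LocalBanachSpace q →L[ℂ] ℂ, ‖f‖ ≤ (w n)⁻¹ ∧
      ∀ x, f (toLocalBanach q x) = 1 * toSeq α s x n := by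
    refine exists_coord (inv_nonneg.2 (hw0 n).le) 1 fun x => ?_
    rw [one_mul, le_inv_mul_iff₀ (hw0 n), hqw]
    exact (hsum x).le_tsum n fun m _ => hterm x m
  choose a ha hae using hcoord
  let y : ℕ → LocalBanachSpace p := fun n => toLocalBanach p (unitVec α s n)
  have hay : Summable fun n => ‖a n‖ * ‖y n‖ := by
    refine Summable.of_nonneg_of_le (fun n => by positivity) (fun n => ?_)
      summable_one_div_add_one_sq
    calc ‖a n‖ * ‖y n‖ ≤ (w n)⁻¹ * u n := by
          gcongr
          · exact inv_nonneg.2 (hw0 n).le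
          · exact ha n
          · exact (norm_toLocalBanach p _).trans_le (hpu n)
      _ = 1 / ((n : ℝ) + 1) ^ 2 := by
          have := (hu0 n).ne'
          simp only [w]
          field_simp
  refine ⟨q, hq, hpq, a, y, hay, ?_⟩
  -- The series converges in operator norm, so its sum need be identified only on the dense image of
  -- `E_α`, where it is the basis expansion.
  have hop : Summable fun n => (a n).smulRight (y n) :=
    Summable.of_norm (by simpa only [ContinuousLinearMap.norm_smulRight_apply] using hay)
  have happ (x : LocalBanachSpace q) :
      HasSum (fun n => a n x • y n) ((∑' n, (a n).smulRight (y n)) x) :=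
    hop.hasSum.mapL (ContinuousLinearMap.apply ℂ (LocalBanachSpace p) x)
  have hext (x : CoechelonSpace α s) :
      (∑' n, (a n).smulRight (y n)) (toLocalBanach q x) = linkingMap hpq (toLocalBanach q x) := by
    refine tendsto_nhds_unique (happ _).tendsto_sum_nat ?_
    rw [tendsto_iff_norm_sub_tendsto_zero]
    refine (tendsto_seminorm_sub_sum hα hs hs_mono hp x).congr fun N => ?_
    rw [← norm_toLocalBanach p, linkingMap_toLocalBanach, map_sub, map_sum]
    congr 2
    refine Finset.sum_congr rfl fun n _ => ?_
    rw [map_smul, hae, one_mul]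
  have hfun : ⇑(∑' n, (a n).smulRight (y n)) = linkingMap hpq :=
    UniformSpace.Completion.ext (ContinuousLinearMap.continuous _)
      (ContinuousLinearMap.continuous _) hext
  intro x
  rw [← hfun]
  exact happ x

/-! ### Nuclearity implies log growth -/

/-- Failure of log growth gives `φ 0 < φ 1 < …` with `1/(φ j + 1) < v_j(φ j)`. Let `w` take this
value on the block of indices ending at `φ j`. Monotonicity in both indices gives `w n ≤ v_j(φ j) ≤
v_j(n) ≤ v_k(n)` once `j ≥ k`. -/
theorem exists_isDominated_not_summable (h : ¬ HasLogGrowth α s) (hα_pos : ∀ n, 0 < α n)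
    (hα : StrictMono α) (hs : ∀ k, 1 < s k) (hs_mono : StrictMono s) :
    ∃ w : ℕ → ℝ, (∀ n, 0 ≤ w n) ∧ IsDominated α s w ∧ ¬ Summable w := by
  have hfreq (k : ℕ) : ∃ᶠ n : ℕ in atTop, 1 < ((n : ℝ) + 1) * coechelonWeight α s k n := by
    intro hev
    obtain ⟨C, -, hC⟩ := exists_forall_le_of_eventually_le_one (hev.mono fun n => not_lt.1)
    exact h ⟨k, C, hC⟩
  obtain ⟨φ, hφ, hφv⟩ := extraction_forall_of_frequently hfreq
  have hex (n : ℕ) : ∃ j, n ≤ φ j := ⟨n, hφ.le_apply⟩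
  have hφpos (j : ℕ) : (0 : ℝ) < φ j + 1 := by positivity
  refine ⟨fun n => 1 / ((φ (Nat.find (hex n)) : ℝ) + 1), fun n => by positivity,
    isDominated_of_eventually_le hs fun k => ?_, fun hsum => ?_⟩
  · filter_upwards [eventually_gt_atTop (φ k)] with n hn
    set j := Nat.find (hex n)
    have hj : n ≤ φ j := Nat.find_spec (hex n)
    have hkj : k ≤ j := (hφ.lt_iff_lt.1 (hn.trans_le hj)).le
    refine le_trans ?_ (coechelonWeight_anti_left hα_pos hs hs_mono n hkj)
    refine le_trans ?_ (coechelonWeight_antitone hα hs j hj)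
    rw [div_le_iff₀' (hφpos j)]
    exact (hφv j).le
  -- If `w` were summable, some tail from `M` would be below `1/2`. But with `m = φ (2 * M) ≥ 2 *
  -- M`, at least half of the indices up to `m` are `≥ M`, each contributing at least `1/(m+1)`.
  · obtain ⟨M, hM⟩ := ((tendsto_sum_nat_add
      fun n => 1 / ((φ (Nat.find (hex n)) : ℝ) + 1)).eventually_lt_const
        (show (0 : ℝ) < 1 / 2 by norm_num)).exists
    have hle : 2 * M ≤ φ (2 * M) := hφ.le_apply
    set m := φ (2 * M)
    have h1 := ((summable_nat_add_iff M).2 hsum).sum_le_tsum (Finset.range (m + 1 - M))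
      fun n _ => by positivity
    have h2 : ((m + 1 - M : ℕ) : ℝ) * (1 / ((m : ℝ) + 1)) ≤ ∑ n ∈ Finset.range (m + 1 - M),
        1 / ((φ (Nat.find (hex (n + M))) : ℝ) + 1) := by
      rw [← nsmul_eq_mul]
      nth_rw 1 [← Finset.card_range (m + 1 - M)]
      refine Finset.card_nsmul_le_sum _ _ _ fun n hn => ?_
      have hn' := Finset.mem_range.1 hn
      have : φ (Nat.find (hex (n + M))) ≤ m :=
        hφ.monotone (Nat.find_min' (hex (n + M)) (by omega))
      gcongr
    have h3 : (1 : ℝ) / 2 ≤ ((m + 1 - M : ℕ) : ℝ) * (1 / ((m : ℝ) + 1)) := by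
      rw [mul_one_div, div_le_div_iff₀ two_pos (by positivity)]
      exact_mod_cast (show 1 * (m + 1) ≤ (m + 1 - M) * 2 by omega)
    linarith

/-- A trace estimate: in a nuclear representation of the linking map, the weighted diagonal entries
`w n` have sums at most `C ∑ ‖a j‖ ‖y j‖`, contradicting non-summability. -/
theorem hasLogGrowth_of_isNuclearSpace (h : IsNuclearSpace (CoechelonSpace α s))
    (hα_pos : ∀ n, 0 < α n) (hα : StrictMono α) (hs : ∀ k, 1 < s k) (hs_mono : StrictMono s) :
    HasLogGrowth α s := by
  by_contra hlog
  obtain ⟨w, hw0, hw, hws⟩ := exists_isDominated_not_summable hlog hα_pos hα hs hs_mono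
  obtain ⟨p, hp, hpw⟩ := exists_continuous_sup_seminorm hα_pos hs hs_mono hw0 hw
  obtain ⟨q, hq, hpq, a, y, hay, hsum⟩ := h p hp
  obtain ⟨C, hC0, hC⟩ := exists_seminorm_le_norm hq 0
  have hcoord (n : ℕ) : ∃ f : LocalBanachSpace p →L[ℂ] ℂ, ‖f‖ ≤ 1 ∧
      ∀ x, f (toLocalBanach p x) = (w n : ℂ) * toSeq α s x n := by
    refine exists_coord zero_le_one _ fun x => ?_
    rw [norm_mul, Complex.norm_real, Real.norm_of_nonneg (hw0 n), one_mul]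
    exact hpw x n
  choose f hf hfe using hcoord
  let e : ℕ → LocalBanachSpace q := fun n => toLocalBanach q (unitVec α s n)
  have htrace (n : ℕ) : HasSum (fun j => a j (e n) * f n (y j)) (w n : ℂ) := by
    have := (hsum (e n)).mapL (f n)
    rw [linkingMap_toLocalBanach, hfe, toSeq_unitVec, Pi.single_eq_same, mul_one] at this
    simpa using this
  -- Unimodular `ε n` align the phases of `a j (e n)`. As `v_0 ≤ 1`, `∑ ε n e n` has norm at most
  -- `1` in step `0`, hence `q`-value at most `C`, uniformly in `F`.
  have hrow (j : ℕ) (F : Finset ℕ) : ∑ n ∈ F, ‖a j (e n)‖ ≤ C * ‖a j‖ := by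
    choose ε hε hεe using fun n => RCLike.exists_norm_eq_mul_self (a j (e n))
    set x := ∑ n ∈ F, ε n • unitVec α s n with hx
    have hqx : q x ≤ C * 1 := by
      refine seminorm_le_of_norm_le hs hC0.le hC (tendsto_weight_sum_unitVec 0 ε F) fun n => ?_
      refine mul_le_one₀ ?_ (norm_nonneg _) ?_
      · exact Real.rpow_le_one_of_one_le_of_nonpos (hs 0).le (neg_nonpos.2 (hα_pos n).le)
      · classical
        rw [toSeq_sum_unitVec]
        split_ifs
        · exact (hε n).le
        · simp
    have hsumeq : ((∑ n ∈ F, ‖a j (e n)‖ : ℝ) : ℂ) = a j (toLocalBanach q x) := by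
      rw [hx, map_sum, map_sum, Complex.ofReal_sum]
      refine Finset.sum_congr rfl fun n _ => ?_
      rw [map_smul, map_smul]
      exact hεe n
    have hnorm : ‖((∑ n ∈ F, ‖a j (e n)‖ : ℝ) : ℂ)‖ ≤ ‖a j‖ * q x := by
      rw [hsumeq, ← norm_toLocalBanach q x]
      exact (a j).le_opNorm _
    rw [Complex.norm_real, Real.norm_of_nonneg (Finset.sum_nonneg fun _ _ => norm_nonneg _)] at hnorm
    calc _ ≤ _ := hnorm
      _ ≤ ‖a j‖ * (C * 1) := by gcongr
      _ = _ := by ring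
  refine hws (summable_of_sum_le (c := C * ∑' j, ‖a j‖ * ‖y j‖) hw0 fun F => ?_)
  have hF := (hasSum_sum fun n (_ : n ∈ F) => htrace n).norm_le_of_bounded
    (hay.hasSum.mul_left C) fun j => by
      calc ‖∑ n ∈ F, a j (e n) * f n (y j)‖ ≤ ∑ n ∈ F, ‖a j (e n)‖ * ‖y j‖ := by
            refine norm_sum_le_of_le _ fun n _ => ?_
            rw [norm_mul]
            gcongr
            exact ((f n).le_of_opNorm_le (hf n) _).trans_eq (one_mul _)
        _ ≤ C * ‖a j‖ * ‖y j‖ := by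
            rw [← Finset.sum_mul]; gcongr; exact hrow j F
        _ = _ := mul_assoc _ _ _
  rw [← Complex.ofReal_sum, Complex.norm_real] at hF
  exact (le_abs_self _).trans hF

end CoechelonSpace

/-! ### The equivalence -/

theorem corollary2p10 (α s : ℕ → ℝ)
    (hα_pos : ∀ n, 0 < α n) (hα : StrictMono α) (hα_top : Tendsto α atTop atTop)
    (hs : ∀ k, 1 < s k) (hs_mono : StrictMono s) (hs_top : Tendsto s atTop atTop) :
    List.TFAE [
      IsNuclearSpace (CoechelonSpace α s),
      spectrum ℂ (CoechelonSpace.cesaro hα hs) = pointSpectrum (CoechelonSpace.cesaro hα hs),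
      spectrum ℂ (CoechelonSpace.cesaro hα hs) = {z : ℂ | ∃ n : ℕ, 0 < n ∧ z = 1 / (n : ℂ)}] := by
  have hset (z : ℂ) : (∃ n : ℕ, 0 < n ∧ z = 1 / (n : ℂ)) ↔ ∃ n : ℕ, z = 1 / ((n : ℂ) + 1) := by
    constructor
    · rintro ⟨n, hn, rfl⟩
      exact ⟨n - 1, by rw [Nat.cast_sub hn]; simp⟩
    · rintro ⟨n, rfl⟩
      exact ⟨n + 1, n.succ_pos, by push_cast; rfl⟩
  have hlog (h : HasLogGrowth α s) : spectrum ℂ (CoechelonSpace.cesaro hα hs) =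
      {z : ℂ | ∃ n : ℕ, 0 < n ∧ z = 1 / (n : ℂ)} := by
    ext z
    rw [Set.mem_ofPred_eq, hset]
    constructor
    · intro hz
      by_contra! hne
      exact CoechelonSpace.notMem_spectrum hα hs h hα_pos hs_mono hs_top hne hz
    · rintro ⟨n, rfl⟩
      exact CoechelonSpace.one_div_mem_spectrum hα hs n
  have hlog' (h : HasLogGrowth α s) : pointSpectrum (CoechelonSpace.cesaro hα hs) =
      {z : ℂ | ∃ n : ℕ, 0 < n ∧ z = 1 / (n : ℂ)} := by
    ext z
    rw [Set.mem_ofPred_eq, hset]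
    refine ⟨CoechelonSpace.pointSpectrum_subset hα hs, ?_⟩
    rintro ⟨n, rfl⟩
    exact CoechelonSpace.one_div_mem_pointSpectrum hα hs h hα_pos hs_mono hs_top n
  tfae_have 1 → 2 := fun h => by
    have hg := CoechelonSpace.hasLogGrowth_of_isNuclearSpace h hα_pos hα hs hs_mono
    rw [hlog hg, hlog' hg]
  tfae_have 2 → 3 := fun h => by
    -- The point `1/2` is in the spectrum unconditionally, hence an eigenvalue by assertion 2.
    refine hlog (CoechelonSpace.hasLogGrowth_of_one_half_mem_pointSpectrum hα hs hα_pos hs_mono ?_)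
    rw [← h]
    convert CoechelonSpace.one_div_mem_spectrum hα hs 1 using 2
    norm_num
  tfae_have 3 → 1 := fun h => by
    refine CoechelonSpace.isNuclearSpace_of_hasLogGrowth
      (CoechelonSpace.hasLogGrowth_of_zero_notMem_spectrum hα hs hα_pos hα_top hs_mono ?_)
      hα_pos hs hs_mono hs_top
    rw [h, Set.mem_ofPred_eq, hset]
    rintro ⟨n, hn⟩
    exact one_div_ne_zero (by exact_mod_cast n.succ_ne_zero) hn.symm
  tfae_finish
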